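/- A full-rank lattice $\Lambda\subset\mathbb R^2$ is called well-rounded (WR) if its minimal vectors, i.e. the nonzero vectors of $\Lambda$ of smallest Euclidean norm, span $\mathbb R^2$. Let $\mathrm{WR}(\mathbb Z^2)$ be the set of all full-rank well-rounded sublattices of $\mathbb Z^2$, and let $\mathcal D=\{\det\Lambda:\Lambda\in\mathrm{WR}(\mathbb Z^2)\}$, where $\det\Lambda$ is the covolume of $\Lambda$. Suppose that $u\in\mathcal D$ has one of the forms (i) $u=p^k$ or $u=2p^k$, where $p$ is a prime and $k\ge 1$ is an integer, or (ii) $u=p_1p_2$, where $p_1,p_2$ are odd primes with $\sqrt3\,p_1<p_2$. Then every $\Lambda\in\mathrm{WR}(\mathbb Z^2)$ with $\det\Lambda=u$ comes from an ideal of norm $u$ in $\mathbb Z[i]$, that is, there is an ideal $I\subseteq\mathbb Z[i]$ of norm $|\mathbb Z[i]/I|=u$ such that $\Lambda=\{(x,y):x+iy\in I\}$; moreover, $\Lambda$ has an orthogonal $\mathbb Z$-basis. -/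

import Mathlib

/-- The integer lattice `ℤ^N` inside the Euclidean space `ℝ^N`. -/
noncomputable def intLattice (N : ℕ) : Submodule ℤ (EuclideanSpace ℝ (Fin N)) :=
  Submodule.span ℤ (Set.range (EuclideanSpace.basisFun (Fin N) ℝ))

/-- The minimal vectors `S(Λ)`: the nonzero vectors of `Λ` at which the Euclidean norm attains its
minimum over `Λ ∖ {0}`. -/
def minimalVectors {N : ℕ} (L : Submodule ℤ (EuclideanSpace ℝ (Fin N))) :
    Set (EuclideanSpace ℝ (Fin N)) :=
  {x | x ∈ L ∧ x ≠ 0 ∧ ∀ y ∈ L, y ≠ 0 → ‖x‖ ≤ ‖y‖}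

/-- A lattice is well-rounded if its minimal vectors span the Euclidean space over `ℝ`. -/
def IsWellRounded {N : ℕ} (L : Submodule ℤ (EuclideanSpace ℝ (Fin N))) : Prop :=
  Submodule.span ℝ (minimalVectors L) = ⊤

/-- `WR(Ω)`: the set of all full-rank well-rounded sublattices of the lattice `Ω`. -/
def WR {N : ℕ} (Ω : Submodule ℤ (EuclideanSpace ℝ (Fin N))) :
    Set (Submodule ℤ (EuclideanSpace ℝ (Fin N))) :=
  {L | L ≤ Ω ∧ Submodule.span ℝ (L : Set (EuclideanSpace ℝ (Fin N))) = ⊤ ∧ IsWellRounded L}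

/-- The set `𝒟` of all determinants (covolumes) of the lattices in `WR(ℤ²)`. -/
def wrDetSet : Set ℝ :=
  {u | ∃ L ∈ WR (intLattice 2), ZLattice.covolume L = u}

/-- The canonical map `x + iy ↦ (x, y)` from `ℤ[i]` to `ℝ²`. -/
noncomputable def gaussianToPlane (z : GaussianInt) : EuclideanSpace ℝ (Fin 2) :=
  !₂[(z.re : ℝ), (z.im : ℝ)]

/-- The norm of an ideal `I` of `ℤ[i]`: the number of elements of `ℤ[i] ⧸ I` (and `0` if this
quotient is infinite, that is, for the zero ideal). -/
noncomputable def gaussianIdealNorm (I : Ideal GaussianInt) : ℕ :=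
  Nat.card (GaussianInt ⧸ I)

/-- The lattice `L` comes from the ideal `I` of `ℤ[i]`: it is its image under the canonical map. -/
def ComesFromIdeal (L : Submodule ℤ (EuclideanSpace ℝ (Fin 2))) (I : Ideal GaussianInt) : Prop :=
  gaussianToPlane '' (I : Set GaussianInt) = (L : Set (EuclideanSpace ℝ (Fin 2)))

/-- `L` has an orthogonal `ℤ`-basis. -/
def HasOrthogonalBasis (L : Submodule ℤ (EuclideanSpace ℝ (Fin 2))) : Prop :=
  ∃ b : Module.Basis (Fin 2) ℤ L,
    inner ℝ (b 0 : EuclideanSpace ℝ (Fin 2)) (b 1 : EuclideanSpace ℝ (Fin 2)) = 0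

/-! Two non-parallel minimal vectors `z`, `w` have equal length and generate `L`; with `m = |z|²`
and `c = z·w`, minimality of `z` against `z ± w` gives `2|c| ≤ m`. Equal length makes `z + w` and `z
- w` orthogonal, so they are `g(p, q)` and `t(-q, p)` with `p`, `q` coprime. Their squared lengths
`2m ± 2c` lie in `[m, 3m]`, hence `g²` and `t²` differ by a factor at most 3, while `|g t| (p² + q²)
= 2u`.

A parity argument turns this into divisibility of `u` by a product `S * T` with `S / T = |g / t|`
(`natAbs_eq_of_special`). For the special `u` this forces `S = T` (`eq_of_mul_dvd_special`). Then `c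
= 0`, so `w = ±i z`, and `L` is the ideal `(z)` with orthogonal basis `z`, `w`. -/

/-! ### Divisors whose ratio is at most √3. -/

theorem eq_of_mul_dvd_prime_pow {p k S T : ℕ} (hp : p.Prime) (h : S * T ∣ p ^ k)
    (h1 : S ^ 2 ≤ 3 * T ^ 2) (h2 : T ^ 2 ≤ 3 * S ^ 2) : S = T := by
  obtain ⟨a, -, rfl⟩ := (Nat.dvd_prime_pow hp).1 (dvd_of_mul_right_dvd h)
  obtain ⟨b, -, rfl⟩ := (Nat.dvd_prime_pow hp).1 (dvd_of_mul_left_dvd h)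
  have key : ∀ a b : ℕ, (p ^ b) ^ 2 ≤ 3 * (p ^ a) ^ 2 → b ≤ a := by
    intro a b hab
    by_contra! hlt
    -- Distinct powers of `p` differ by a factor at least 2, which exceeds √3.
    have hle : p ^ (a + 1) ≤ p ^ b := Nat.pow_le_pow_right hp.pos hlt
    have h3 : p ^ a * 2 ≤ p ^ b := (Nat.mul_le_mul_left _ hp.two_le).trans (by rwa [← pow_succ])
    have h4 : 0 < p ^ a := pow_pos hp.pos _
    nlinarith
  rw [le_antisymm (key b a h1) (key a b h2)]

/-- The parity condition excludes pairs such as `{1, 2}` with `p` odd; only the factor 2 could break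
the prime-power argument. -/
theorem eq_of_mul_dvd_two_mul_prime_pow {p k S T : ℕ} (hp : p.Prime)
    (h : 2 * (S * T) ∣ 2 * p ^ k ∨ S % 2 = T % 2 ∧ S * T ∣ 2 * p ^ k)
    (h1 : S ^ 2 ≤ 3 * T ^ 2) (h2 : T ^ 2 ≤ 3 * S ^ 2) : S = T := by
  rcases h with h | ⟨hpar, h⟩
  · exact eq_of_mul_dvd_prime_pow hp (Nat.dvd_of_mul_dvd_mul_left two_pos h) h1 h2
  rcases Nat.even_or_odd S with hS | hS
  · have hT : Even T := by rw [Nat.even_iff] at hS ⊢; omega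
    have h4 : 2 * 2 ∣ 2 * p ^ k := (mul_dvd_mul hS.two_dvd hT.two_dvd).trans h
    have h5 : 2 ∣ p := Nat.prime_two.dvd_of_dvd_pow (Nat.dvd_of_mul_dvd_mul_left two_pos h4)
    obtain rfl : 2 = p := (Nat.prime_dvd_prime_iff_eq Nat.prime_two hp).1 h5
    exact eq_of_mul_dvd_prime_pow (k := k + 1) hp (by rwa [pow_succ']) h1 h2
  · have hT : Odd T := by rw [Nat.odd_iff] at hS ⊢; omega
    refine eq_of_mul_dvd_prime_pow (k := k) hp ?_ h1 h2
    exact (Nat.coprime_two_right.2 (hS.mul hT)).dvd_of_dvd_mul_left h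

/-- In the chain `1 < p < q < pq` of divisors, every consecutive ratio exceeds √3. -/
theorem eq_of_dvd_mul_primes {p q S T : ℕ} (hp : p.Prime) (hp3 : 3 ≤ p) (hq : q.Prime)
    (hpq : 3 * p ^ 2 < q ^ 2) (hS : S ∣ p * q) (hT : T ∣ p * q)
    (h1 : S ^ 2 ≤ 3 * T ^ 2) (h2 : T ^ 2 ≤ 3 * S ^ 2) : S = T := by
  obtain ⟨a, b, ha, hb, rfl⟩ := (Nat.dvd_mul).1 hS
  obtain ⟨c, d, hc, hd, rfl⟩ := (Nat.dvd_mul).1 hT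
  have h9 : 3 * 3 ≤ p ^ 2 := by nlinarith
  have h10 : p ^ 2 * 3 < p ^ 2 * q ^ 2 := Nat.mul_lt_mul_of_pos_left (by omega) (by omega)
  have h11 : 3 * q ^ 2 < p ^ 2 * q ^ 2 := Nat.mul_lt_mul_of_pos_right (by omega) (by omega)
  rcases (Nat.dvd_prime hp).1 ha with rfl | rfl <;> rcases (Nat.dvd_prime hq).1 hb with rfl | rfl <;>
  rcases (Nat.dvd_prime hp).1 hc with rfl | rfl <;> rcases (Nat.dvd_prime hq).1 hd with rfl | rfl <;>
  first
  | rfl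
  | (simp only [mul_pow, one_pow, one_mul, mul_one] at h1 h2; omega)

theorem eq_of_mul_dvd_special {u S T : ℕ}
    (hu : (∃ p k : ℕ, p.Prime ∧ 1 ≤ k ∧ (u = p ^ k ∨ u = 2 * p ^ k)) ∨
      (∃ p₁ p₂ : ℕ, p₁.Prime ∧ Odd p₁ ∧ p₂.Prime ∧ Odd p₂ ∧
        √3 * (p₁ : ℝ) < (p₂ : ℝ) ∧ u = p₁ * p₂))
    (h : 2 * (S * T) ∣ u ∨ S % 2 = T % 2 ∧ S * T ∣ u)
    (h1 : S ^ 2 ≤ 3 * T ^ 2) (h2 : T ^ 2 ≤ 3 * S ^ 2) : S = T := by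
  have hd : S * T ∣ u := h.elim dvd_of_mul_left_dvd And.right
  rcases hu with ⟨p, k, hp, -, rfl | rfl⟩ | ⟨p, q, hp, hpo, hq, -, hpq, rfl⟩
  · exact eq_of_mul_dvd_prime_pow hp hd h1 h2
  · exact eq_of_mul_dvd_two_mul_prime_pow hp h h1 h2
  · have hp3 : 3 ≤ p := by
      have := hp.two_le
      rcases hpo with ⟨j, rfl⟩
      omega
    refine eq_of_dvd_mul_primes hp hp3 hq ?_ (dvd_of_mul_right_dvd hd) (dvd_of_mul_left_dvd hd) h1 h2
    have h3 : (√3 * (p : ℝ)) ^ 2 < (q : ℝ) ^ 2 := pow_lt_pow_left₀ hpq (by positivity) two_ne_zero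
    rw [mul_pow, Real.sq_sqrt (by norm_num)] at h3
    exact_mod_cast h3

/-! ### The sum and difference of two integer vectors of equal length. -/

/-- Two orthogonal nonzero integer vectors are multiples of a primitive vector and its rotation. -/
theorem exists_primitive_of_orthogonal {a₁ a₂ b₁ b₂ : ℤ} (ha : a₁ ≠ 0 ∨ a₂ ≠ 0)
    (h : a₁ * b₁ + a₂ * b₂ = 0) :
    ∃ g t p q : ℤ, IsCoprime p q ∧ a₁ = g * p ∧ a₂ = g * q ∧ b₁ = -(t * q) ∧ b₂ = t * p := by
  have hg : 0 < Int.gcd a₁ a₂ := Int.gcd_pos_iff.2 ha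
  obtain ⟨p, q, hpq, h1, h2⟩ := Int.exists_gcd_one hg
  have hg' : ((Int.gcd a₁ a₂ : ℕ) : ℤ) ≠ 0 := by exact_mod_cast hg.ne'
  generalize ((Int.gcd a₁ a₂ : ℕ) : ℤ) = g at *
  subst h1 h2
  have hpq' : IsCoprime p q := Int.isCoprime_iff_gcd_eq_one.2 hpq
  have h0 : p * b₁ + q * b₂ = 0 := by
    apply (mul_eq_zero.1 (_ : g * (p * b₁ + q * b₂) = 0)).resolve_left hg'
    linear_combination h
  obtain ⟨e, f, hef⟩ := id hpq'
  -- The multiplier `t` is read off from the Bézout relation `e * p + f * q = 1`.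
  refine ⟨g, e * b₂ - f * b₁, p, q, hpq', mul_comm _ _, mul_comm _ _, ?_, ?_⟩
  · linear_combination e * h0 - b₁ * hef
  · linear_combination f * h0 - b₂ * hef

theorem natAbs_eq_of_special {u : ℕ}
    (hu : (∃ p k : ℕ, p.Prime ∧ 1 ≤ k ∧ (u = p ^ k ∨ u = 2 * p ^ k)) ∨
      (∃ p₁ p₂ : ℕ, p₁.Prime ∧ Odd p₁ ∧ p₂.Prime ∧ Odd p₂ ∧
        √3 * (p₁ : ℝ) < (p₂ : ℝ) ∧ u = p₁ * p₂))
    {g t p q : ℤ} (hpq : IsCoprime p q)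
    (hpar₁ : Even (g * p - t * q)) (hpar₂ : Even (g * q + t * p))
    (hDn : g.natAbs * t.natAbs * (p ^ 2 + q ^ 2).natAbs = 2 * u)
    (h1' : g.natAbs ^ 2 ≤ 3 * t.natAbs ^ 2) (h2' : t.natAbs ^ 2 ≤ 3 * g.natAbs ^ 2) :
    g.natAbs = t.natAbs := by
  rcases Int.even_or_odd (p ^ 2 + q ^ 2) with hev | hodd
  · have hpo : Odd p ∧ Odd q := by
      by_contra hcon
      have : Even p ∧ Even q := by
        simp only [← Int.not_even_iff_odd, Int.even_add, Int.even_pow] at hcon hev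
        tauto
      have h2u := hpq.isUnit_of_dvd' this.1.two_dvd this.2.two_dvd
      exact absurd h2u (by decide)
    -- With `p`, `q` odd, the factor 2 of `2 * u` is absorbed by `p² + q²`, and `g`, `t` have equal
    -- parity.
    refine eq_of_mul_dvd_special hu (Or.inr ⟨?_, ?_⟩) h1' h2'
    · have hpar : Even (g * p - t * q) := hpar₁
      obtain ⟨hp, hq⟩ := hpo
      simp only [← Int.not_even_iff_odd, Int.even_sub, Int.even_mul] at hp hq hpar
      have : Even g ↔ Even t := by tauto
      simp only [Int.even_iff] at this
      omega
    · obtain ⟨n, hn'⟩ := Int.natAbs_even.2 hev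
      rw [hn'] at hDn
      have hn2 : 2 * (g.natAbs * t.natAbs * n) = 2 * u := by rw [← hDn]; ring
      exact ⟨n, (Nat.eq_of_mul_eq_mul_left two_pos hn2).symm⟩
  -- Exactly one of `p`, `q` is odd, so both multipliers are even; halving them leaves `2 * (S * T)
  -- ∣ u`.
  · have hge : Even g ∧ Even t := by
      have hpar : Even (g * p - t * q) := hpar₁
      have hpar' : Even (g * q + t * p) := hpar₂
      simp only [← Int.not_even_iff_odd, Int.even_sub, Int.even_add, Int.even_mul,
        Int.even_pow] at hodd hpar hpar'
      tauto
    obtain ⟨S, hS⟩ := Int.natAbs_even.2 hge.1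
    obtain ⟨T, hT⟩ := Int.natAbs_even.2 hge.2
    rw [hS, hT] at hDn h1' h2' ⊢
    have half : ∀ a b : ℕ, (a + a) ^ 2 ≤ 3 * (b + b) ^ 2 → a ^ 2 ≤ 3 * b ^ 2 := by
      intro a b hab
      linarith
    have hST : 2 * (2 * (S * T) * (p ^ 2 + q ^ 2).natAbs) = 2 * u := by rw [← hDn]; ring
    have : S = T := eq_of_mul_dvd_special hu
      (Or.inl ⟨_, (Nat.eq_of_mul_eq_mul_left two_pos hST).symm⟩) (half _ _ h1') (half _ _ h2')
    rw [this]

theorem dot_eq_zero_of_special {u : ℕ}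
    (hu : (∃ p k : ℕ, p.Prime ∧ 1 ≤ k ∧ (u = p ^ k ∨ u = 2 * p ^ k)) ∨
      (∃ p₁ p₂ : ℕ, p₁.Prime ∧ Odd p₁ ∧ p₂.Prime ∧ Odd p₂ ∧
        √3 * (p₁ : ℝ) < (p₂ : ℝ) ∧ u = p₁ * p₂))
    {x₁ x₂ y₁ y₂ : ℤ} (hdet : (x₁ * y₂ - x₂ * y₁).natAbs = u) (hdet0 : x₁ * y₂ - x₂ * y₁ ≠ 0)
    (hxy : x₁ ^ 2 + x₂ ^ 2 = y₁ ^ 2 + y₂ ^ 2)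
    (hc : 2 * |x₁ * y₁ + x₂ * y₂| ≤ x₁ ^ 2 + x₂ ^ 2) : x₁ * y₁ + x₂ * y₂ = 0 := by
  have ha : x₁ + y₁ ≠ 0 ∨ x₂ + y₂ ≠ 0 := by
    by_contra! hcon
    apply hdet0
    linear_combination x₁ * hcon.2 - x₂ * hcon.1
  obtain ⟨g, t, p, q, hpq, e1, e2, e3, e4⟩ :=
    exists_primitive_of_orthogonal (b₁ := x₁ - y₁) (b₂ := x₂ - y₂) ha (by linear_combination hxy)
  have hn : 0 < p ^ 2 + q ^ 2 := by
    have : p ^ 2 + q ^ 2 ≠ 0 := by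
      intro h0
      have hp : p = 0 := by nlinarith [sq_nonneg p, sq_nonneg q]
      have hq : q = 0 := by nlinarith [sq_nonneg p, sq_nonneg q]
      subst hp hq
      exact not_isCoprime_zero_zero hpq
    positivity
  have hA : g ^ 2 * (p ^ 2 + q ^ 2) = 2 * (x₁ ^ 2 + x₂ ^ 2) + 2 * (x₁ * y₁ + x₂ * y₂) := by
    linear_combination -(x₁ + y₁ + g * p) * e1 - (x₂ + y₂ + g * q) * e2 - hxy
  have hB : t ^ 2 * (p ^ 2 + q ^ 2) = 2 * (x₁ ^ 2 + x₂ ^ 2) - 2 * (x₁ * y₁ + x₂ * y₂) := by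
    linear_combination -(x₁ - y₁ - t * q) * e3 - (x₂ - y₂ + t * p) * e4 - hxy
  have hD : g * t * (p ^ 2 + q ^ 2) = -2 * (x₁ * y₂ - x₂ * y₁) := by
    linear_combination -(x₂ - y₂) * e1 - g * p * e4 + (x₁ - y₁) * e2 + g * q * e3
  have hc1 := neg_abs_le (x₁ * y₁ + x₂ * y₂)
  have hc2 := le_abs_self (x₁ * y₁ + x₂ * y₂)
  have h1 : g ^ 2 ≤ 3 * t ^ 2 := by
    refine le_of_mul_le_mul_right ?_ hn
    linarith
  have h2 : t ^ 2 ≤ 3 * g ^ 2 := by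
    refine le_of_mul_le_mul_right ?_ hn
    linarith
  have hDn : g.natAbs * t.natAbs * (p ^ 2 + q ^ 2).natAbs = 2 * u := by
    rw [← hdet, ← Int.natAbs_mul, ← Int.natAbs_mul, hD, Int.natAbs_mul]; rfl
  have h1' : g.natAbs ^ 2 ≤ 3 * t.natAbs ^ 2 := by zify; simpa using h1
  have h2' : t.natAbs ^ 2 ≤ 3 * g.natAbs ^ 2 := by zify; simpa using h2
  have hgt : g.natAbs = t.natAbs := natAbs_eq_of_special hu hpq
    ⟨x₁, by linear_combination -e1 - e3⟩ ⟨x₂, by linear_combination -e2 - e4⟩ hDn h1' h2'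
  have hsq : g ^ 2 = t ^ 2 := by rw [← Int.natAbs_sq g, ← Int.natAbs_sq t, hgt]
  rw [hsq] at hA
  linarith

/-! ### Gaussian integers as points of the plane. -/

theorem gaussianToPlane_add (z w : GaussianInt) :
    gaussianToPlane (z + w) = gaussianToPlane z + gaussianToPlane w := by
  ext i; fin_cases i <;> simp [gaussianToPlane]

theorem gaussianToPlane_zsmul (n : ℤ) (z : GaussianInt) :
    gaussianToPlane (n • z) = n • gaussianToPlane z := by
  ext i; fin_cases i <;> simp [gaussianToPlane]

theorem gaussianToPlane_injective : Function.Injective gaussianToPlane := by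
  intro z w h
  have h0 := congrArg (fun v : EuclideanSpace ℝ (Fin 2) => v 0) h
  have h1 := congrArg (fun v : EuclideanSpace ℝ (Fin 2) => v 1) h
  simp only [gaussianToPlane, PiLp.toLp_apply, Matrix.cons_val_zero, Matrix.cons_val_one,
    Int.cast_inj] at h0 h1
  exact Zsqrtd.ext h0 h1

theorem gaussianToPlane_zero : gaussianToPlane 0 = 0 := by
  ext i; fin_cases i <;> simp [gaussianToPlane]

theorem inner_gaussianToPlane (z w : GaussianInt) :
    inner ℝ (gaussianToPlane z) (gaussianToPlane w) = ((z.re * w.re + z.im * w.im : ℤ) : ℝ) := by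
  simp [gaussianToPlane, PiLp.inner_apply, Fin.sum_univ_two]
  ring

theorem norm_gaussianToPlane_le_iff (z w : GaussianInt) :
    ‖gaussianToPlane z‖ ≤ ‖gaussianToPlane w‖ ↔ z.re ^ 2 + z.im ^ 2 ≤ w.re ^ 2 + w.im ^ 2 := by
  rw [← sq_le_sq₀ (norm_nonneg _) (norm_nonneg _), ← real_inner_self_eq_norm_sq,
    ← real_inner_self_eq_norm_sq, inner_gaussianToPlane, inner_gaussianToPlane, Int.cast_le]
  simp only [sq]

theorem exists_gaussianToPlane_eq {v : EuclideanSpace ℝ (Fin 2)} (hv : v ∈ intLattice 2) :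
    ∃ z, gaussianToPlane z = v := by
  induction hv using Submodule.span_induction with
  | mem x hx =>
    obtain ⟨i, rfl⟩ := hx
    fin_cases i
    · exact ⟨⟨1, 0⟩, by ext i; fin_cases i <;> simp [gaussianToPlane]⟩
    · exact ⟨⟨0, 1⟩, by ext i; fin_cases i <;> simp [gaussianToPlane]⟩
  | zero => exact ⟨0, gaussianToPlane_zero⟩
  | add x y _ _ hx hy =>
    obtain ⟨z, rfl⟩ := hx
    obtain ⟨w, rfl⟩ := hy
    exact ⟨z + w, gaussianToPlane_add z w⟩
  | smul n x _ hx =>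
    obtain ⟨z, rfl⟩ := hx
    exact ⟨n • z, gaussianToPlane_zsmul n z⟩

/-! ### Non-parallel minimal vectors generate the lattice. -/

theorem exists_mem_cross_ne_zero {S : Set (EuclideanSpace ℝ (Fin 2))}
    (hS : Submodule.span ℝ S = ⊤) :
    ∃ x ∈ S, ∃ y ∈ S, x 0 * y 1 - x 1 * y 0 ≠ 0 := by
  have key : ∀ x : EuclideanSpace ℝ (Fin 2), x ≠ 0 → ∃ y ∈ S, x 0 * y 1 - x 1 * y 0 ≠ 0 := by
    intro x hx
    by_contra! hcon
    have hall : ∀ v : EuclideanSpace ℝ (Fin 2), x 0 * v 1 - x 1 * v 0 = 0 := by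
      intro v
      have hv : v ∈ Submodule.span ℝ S := hS ▸ Submodule.mem_top
      induction hv using Submodule.span_induction with
      | mem y hy => exact hcon y hy
      | zero => simp
      | add y z _ _ hy hz => simp only [PiLp.add_apply]; linear_combination hy + hz
      | smul a y _ hy => simp only [PiLp.smul_apply, smul_eq_mul]; linear_combination a * hy
    apply hx
    have h0 := hall !₂[0, 1]
    have h1 := hall !₂[1, 0]
    simp at h0 h1
    ext i; fin_cases i <;> simp [h0, h1]
  obtain ⟨x, hxS, hx⟩ : ∃ x ∈ S, x ≠ 0 := by
    -- Any nonzero vector would do here: a vector with nonzero cross product against it is itself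
    -- nonzero.
    obtain ⟨y, hy, hne⟩ := key !₂[1, 0] (fun h => by
      simpa using congrArg (fun v : EuclideanSpace ℝ (Fin 2) => v 0) h)
    exact ⟨y, hy, by rintro rfl; simp at hne⟩
  exact ⟨x, hxS, key x hx⟩

/-- If `z` and `w` are non-parallel minimal vectors of a planar lattice `M`, they generate `M`. -/
theorem exists_zsmul_add_zsmul_of_minimal {M : AddSubgroup GaussianInt} {z w : GaussianInt}
    (hz : z ∈ M) (hw : w ∈ M) (hzw : z.re * w.im - z.im * w.re ≠ 0)
    (hnorm : z.re ^ 2 + z.im ^ 2 = w.re ^ 2 + w.im ^ 2)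
    (hmin : ∀ r ∈ M, r ≠ 0 → z.re ^ 2 + z.im ^ 2 ≤ r.re ^ 2 + r.im ^ 2)
    {r : GaussianInt} (hr : r ∈ M) : ∃ a b : ℤ, r = a • z + b • w := by
  have hD : ((z.re : ℝ) * w.im - z.im * w.re) ≠ 0 := by exact_mod_cast hzw
  obtain ⟨α, hα⟩ : ∃ α : ℝ, α * ((z.re : ℝ) * w.im - z.im * w.re) = r.re * w.im - r.im * w.re :=
    ⟨_, div_mul_cancel₀ _ hD⟩
  obtain ⟨β, hβ⟩ : ∃ β : ℝ, β * ((z.re : ℝ) * w.im - z.im * w.re) = z.re * r.im - z.im * r.re :=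
    ⟨_, div_mul_cancel₀ _ hD⟩
  have hre : (r.re : ℝ) = α * z.re + β * w.re := by
    apply mul_right_cancel₀ hD
    linear_combination -z.re * hα - w.re * hβ
  have him : (r.im : ℝ) = α * z.im + β * w.im := by
    apply mul_right_cancel₀ hD
    linear_combination -z.im * hα - w.im * hβ
  -- Subtracting the rounded combination leaves `x z + y w` with `|x|, |y| ≤ 1/2`; if nonzero, it
  -- would be shorter than `z`.
  refine ⟨round α, round β, ?_⟩
  by_contra hne
  have hs : r - (round α • z + round β • w) ∈ M :=
    M.sub_mem hr (M.add_mem (M.zsmul_mem hz _) (M.zsmul_mem hw _))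
  have hle := hmin _ hs (sub_ne_zero.2 hne)
  have hnorm' : (z.re : ℝ) ^ 2 + z.im ^ 2 = w.re ^ 2 + w.im ^ 2 := by exact_mod_cast hnorm
  have hle' : (z.re : ℝ) ^ 2 + z.im ^ 2 ≤
      ((α - round α) * z.re + (β - round β) * w.re) ^ 2 +
      ((α - round α) * z.im + (β - round β) * w.im) ^ 2 := by
    have : (z.re : ℝ) ^ 2 + z.im ^ 2 ≤
      (r.re - (round α * z.re + round β * w.re)) ^ 2 +
      (r.im - (round α * z.im + round β * w.im)) ^ 2 := by
      simp at hle
      exact_mod_cast hle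
    rw [hre, him] at this
    linarith
  have hα2 := abs_sub_round α
  have hβ2 := abs_sub_round β
  generalize α - round α = x at *
  generalize β - round β = y at *
  have hx2 : x ^ 2 ≤ 1 / 4 := by rw [← sq_abs]; nlinarith [abs_nonneg x]
  have hy2 : y ^ 2 ≤ 1 / 4 := by rw [← sq_abs]; nlinarith [abs_nonneg y]
  generalize (z.re : ℝ) = z1 at *
  generalize (z.im : ℝ) = z2 at *
  generalize (w.re : ℝ) = w1 at *
  generalize (w.im : ℝ) = w2 at *
  have hD2 : 0 < (z1 * w2 - z2 * w1) ^ 2 := by positivity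
  -- Cauchy–Schwarz is strict for non-parallel vectors; this covers the extreme case `|x| = |y| =
  -- 1/2`.
  have hcs : (z1 * w1 + z2 * w2) ^ 2 < (z1 ^ 2 + z2 ^ 2) ^ 2 := by
    have : (z1 * w1 + z2 * w2) ^ 2 + (z1 * w2 - z2 * w1) ^ 2
        = (z1 ^ 2 + z2 ^ 2) * (w1 ^ 2 + w2 ^ 2) := by ring
    rw [← hnorm', ← sq] at this
    linarith
  have hm : 0 ≤ z1 ^ 2 + z2 ^ 2 := by positivity
  have habs := abs_lt_of_sq_lt_sq hcs hm
  have hxy : |x * y| ≤ 1 / 4 := by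
    rw [abs_mul]
    nlinarith [abs_nonneg x, abs_nonneg y]
  have hprod : x * y * (z1 * w1 + z2 * w2) ≤ 1 / 4 * (z1 ^ 2 + z2 ^ 2) := by
    refine (le_abs_self _).trans ?_
    rw [abs_mul]
    exact mul_le_mul hxy habs.le (abs_nonneg _) (by norm_num)
  have hstrict : 2 * (x * y * (z1 * w1 + z2 * w2)) < 1 / 2 * (z1 ^ 2 + z2 ^ 2) := by
    have : x * y * (z1 * w1 + z2 * w2) ≤ 1 / 4 * |z1 * w1 + z2 * w2| := by
      refine (le_abs_self _).trans ?_
      rw [abs_mul]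
      exact mul_le_mul_of_nonneg_right hxy (abs_nonneg _)
    linarith
  have h3 : x ^ 2 * (z1 ^ 2 + z2 ^ 2) ≤ 1 / 4 * (z1 ^ 2 + z2 ^ 2) :=
    mul_le_mul_of_nonneg_right hx2 hm
  have h4 : y ^ 2 * (z1 ^ 2 + z2 ^ 2) ≤ 1 / 4 * (z1 ^ 2 + z2 ^ 2) :=
    mul_le_mul_of_nonneg_right hy2 hm
  have hexp : (x * z1 + y * w1) ^ 2 + (x * z2 + y * w2) ^ 2 = x ^ 2 * (z1 ^ 2 + z2 ^ 2) +
      y ^ 2 * (z1 ^ 2 + z2 ^ 2) + 2 * (x * y * (z1 * w1 + z2 * w2)) := by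
    rw [show y ^ 2 * (z1 ^ 2 + z2 ^ 2) = y ^ 2 * (w1 ^ 2 + w2 ^ 2) by rw [hnorm']]
    ring
  linarith

/-! ### Ideal norms, covolumes and bases. -/

/-- The `ℤ`-basis `1, i` of the Gaussian integers. -/
noncomputable def gaussianBasis : Module.Basis (Fin 2) ℤ GaussianInt :=
  Module.Basis.ofEquivFun
    { toFun := fun z => ![z.re, z.im]
      invFun := fun v => ⟨v 0, v 1⟩
      map_add' := fun z w => by ext i; fin_cases i <;> simp
      map_smul' := fun n z => by ext i; fin_cases i <;> simp
      left_inv := fun z => rfl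
      right_inv := fun v => by ext i; fin_cases i <;> rfl }

theorem gaussianBasis_repr (z : GaussianInt) :
    ⇑(gaussianBasis.repr z) = ![z.re, z.im] := rfl

theorem gaussianBasis_zero : gaussianBasis 0 = 1 := by
  rw [gaussianBasis, Module.Basis.coe_ofEquivFun]; rfl

theorem gaussianBasis_one : gaussianBasis 1 = ⟨0, 1⟩ := by
  rw [gaussianBasis, Module.Basis.coe_ofEquivFun]; rfl

theorem algebraNorm_gaussianInt (z : GaussianInt) :
    Algebra.norm ℤ z = z.re ^ 2 + z.im ^ 2 := by
  rw [Algebra.norm_eq_matrix_det gaussianBasis, Matrix.det_fin_two]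
  simp only [Algebra.leftMulMatrix_eq_repr_mul, gaussianBasis_repr, gaussianBasis_zero,
    gaussianBasis_one]
  simp
  ring

theorem gaussianIdealNorm_span_singleton (z : GaussianInt) :
    gaussianIdealNorm (Ideal.span {z}) = (z.re ^ 2 + z.im ^ 2).natAbs := by
  have : Module.Free ℤ GaussianInt := Module.Free.of_basis gaussianBasis
  have : Module.Finite ℤ GaussianInt := Module.Finite.of_basis gaussianBasis
  rw [← algebraNorm_gaussianInt, ← Ideal.absNorm_span_singleton]
  rfl

theorem discreteTopology_of_le_intLattice {N : ℕ} {L : Submodule ℤ (EuclideanSpace ℝ (Fin N))}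
    (hL : L ≤ intLattice N) : DiscreteTopology L := by
  have h : DiscreteTopology
      (Submodule.span ℤ (Set.range (EuclideanSpace.basisFun (Fin N) ℝ).toBasis)) := inferInstance
  rw [OrthonormalBasis.coe_toBasis] at h
  exact DiscreteTopology.of_subset h hL

theorem covolume_eq_abs_det {L : Submodule ℤ (EuclideanSpace ℝ (Fin 2))}
    [DiscreteTopology L] [IsZLattice ℝ L] (b : Module.Basis (Fin 2) ℤ L) :
    ZLattice.covolume L = |(b 0 : EuclideanSpace ℝ (Fin 2)) 0 * (b 1 : EuclideanSpace ℝ (Fin 2)) 1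
      - (b 0 : EuclideanSpace ℝ (Fin 2)) 1 * (b 1 : EuclideanSpace ℝ (Fin 2)) 0| := by
  rw [ZLattice.covolume_eq_det_mul_measureReal L _ b (EuclideanSpace.basisFun (Fin 2) ℝ).toBasis,
    MeasureTheory.measureReal_congr (ZSpan.fundamentalDomain_ae_parallelepiped _ _),
    OrthonormalBasis.coe_toBasis, MeasureTheory.measureReal_def,
    OrthonormalBasis.volume_parallelepiped, Module.Basis.det_apply, Matrix.det_fin_two]
  simp [Module.Basis.toMatrix_apply]
  ring_nf

theorem exists_basis_gaussianToPlane {L : Submodule ℤ (EuclideanSpace ℝ (Fin 2))}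
    {z w : GaussianInt} (hz : gaussianToPlane z ∈ L) (hw : gaussianToPlane w ∈ L)
    (hzw : z.re * w.im - z.im * w.re ≠ 0)
    (hgen : ∀ v ∈ L, ∃ a b : ℤ, v = gaussianToPlane (a • z + b • w)) :
    ∃ b : Module.Basis (Fin 2) ℤ L, (b 0 : EuclideanSpace ℝ (Fin 2)) = gaussianToPlane z ∧
      (b 1 : EuclideanSpace ℝ (Fin 2)) = gaussianToPlane w := by
  have hli : LinearIndependent ℤ ![(⟨_, hz⟩ : L), ⟨_, hw⟩] := by
    rw [LinearIndependent.pair_iff]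
    intro s t hst
    have h : gaussianToPlane (s • z + t • w) = gaussianToPlane 0 := by
      rw [gaussianToPlane_add, gaussianToPlane_zsmul, gaussianToPlane_zsmul, gaussianToPlane_zero]
      simpa using congrArg Subtype.val hst
    have h' := gaussianToPlane_injective h
    have h0 := congrArg Zsqrtd.re h'
    have h1 := congrArg Zsqrtd.im h'
    simp at h0 h1
    constructor
    · apply (mul_eq_zero.1 (_ : s * (z.re * w.im - z.im * w.re) = 0)).resolve_right hzw
      linear_combination w.im * h0 - w.re * h1
    · apply (mul_eq_zero.1 (_ : t * (z.re * w.im - z.im * w.re) = 0)).resolve_right hzw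
      linear_combination z.re * h1 - z.im * h0
  have hspan : ⊤ ≤ Submodule.span ℤ (Set.range ![(⟨_, hz⟩ : L), ⟨_, hw⟩]) := by
    rintro ⟨v, hv⟩ -
    obtain ⟨a, b, rfl⟩ := hgen v hv
    rw [Matrix.range_cons, Matrix.range_cons, Matrix.range_empty, Set.union_empty,
      Set.singleton_union, Submodule.mem_span_pair]
    refine ⟨a, b, Subtype.ext ?_⟩
    change a • gaussianToPlane z + b • gaussianToPlane w = gaussianToPlane (a • z + b • w)
    rw [gaussianToPlane_add, gaussianToPlane_zsmul, gaussianToPlane_zsmul]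
  refine ⟨Module.Basis.mk hli hspan, ?_, ?_⟩ <;> simp

/-! ### From minimal vectors to a principal ideal. -/

theorem exists_minimal_generators {L : Submodule ℤ (EuclideanSpace ℝ (Fin 2))}
    (hL : L ∈ WR (intLattice 2)) :
    ∃ z w : GaussianInt, gaussianToPlane z ∈ L ∧ gaussianToPlane w ∈ L ∧
      z.re * w.im - z.im * w.re ≠ 0 ∧ z.re ^ 2 + z.im ^ 2 = w.re ^ 2 + w.im ^ 2 ∧
      2 * |z.re * w.re + z.im * w.im| ≤ z.re ^ 2 + z.im ^ 2 ∧
      ∀ v ∈ L, ∃ a b : ℤ, v = gaussianToPlane (a • z + b • w) := by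
  obtain ⟨hle, -, hwr⟩ := hL
  obtain ⟨x, ⟨hxL, hx0, hxmin⟩, y, ⟨hyL, hy0, hymin⟩, hxy⟩ := exists_mem_cross_ne_zero hwr
  obtain ⟨z, rfl⟩ := exists_gaussianToPlane_eq (hle hxL)
  obtain ⟨w, rfl⟩ := exists_gaussianToPlane_eq (hle hyL)
  have hzw : z.re * w.im - z.im * w.re ≠ 0 := by
    intro h
    apply hxy
    simp only [gaussianToPlane, PiLp.toLp_apply, Matrix.cons_val_zero, Matrix.cons_val_one]
    exact_mod_cast h
  have hnorm : z.re ^ 2 + z.im ^ 2 = w.re ^ 2 + w.im ^ 2 :=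
    le_antisymm ((norm_gaussianToPlane_le_iff z w).1 (hxmin _ hyL hy0))
      ((norm_gaussianToPlane_le_iff w z).1 (hymin _ hxL hx0))
  let M : AddSubgroup GaussianInt :=
    { carrier := {r | gaussianToPlane r ∈ L}
      add_mem' := fun {a b} ha hb => by
        change gaussianToPlane (a + b) ∈ L
        rw [gaussianToPlane_add]
        exact L.add_mem ha hb
      zero_mem' := by
        change gaussianToPlane 0 ∈ L
        rw [gaussianToPlane_zero]
        exact L.zero_mem
      neg_mem' := fun {a} ha => by
        change gaussianToPlane (-a) ∈ L
        rw [← neg_one_zsmul, gaussianToPlane_zsmul]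
        exact L.smul_mem _ ha }
  have hmin : ∀ r ∈ M, r ≠ 0 → z.re ^ 2 + z.im ^ 2 ≤ r.re ^ 2 + r.im ^ 2 := fun r hr hr0 =>
    (norm_gaussianToPlane_le_iff z r).1 <| hxmin _ hr fun h =>
      hr0 (gaussianToPlane_injective (h.trans gaussianToPlane_zero.symm))
  have hzM : z ∈ M := hxL
  have hwM : w ∈ M := hyL
  refine ⟨z, w, hxL, hyL, hzw, hnorm, ?_, ?_⟩
  · have hp := hmin _ (M.add_mem hzM hwM) (by
      intro h
      have h0 := congrArg Zsqrtd.re h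
      have h1 := congrArg Zsqrtd.im h
      simp at h0 h1
      apply hzw
      linear_combination z.re * h1 - z.im * h0)
    have hm := hmin _ (M.sub_mem hzM hwM) (by
      intro h
      have h0 := congrArg Zsqrtd.re h
      have h1 := congrArg Zsqrtd.im h
      simp at h0 h1
      apply hzw
      linear_combination z.im * h0 - z.re * h1)
    simp only [Zsqrtd.re_add, Zsqrtd.im_add, Zsqrtd.re_sub, Zsqrtd.im_sub] at hp hm
    have : |2 * (z.re * w.re + z.im * w.im)| ≤ z.re ^ 2 + z.im ^ 2 :=
      abs_le.2 ⟨by linarith, by linarith⟩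
    rwa [abs_mul, abs_two] at this
  · intro v hv
    obtain ⟨r, rfl⟩ := exists_gaussianToPlane_eq (hle hv)
    obtain ⟨a, b, hab⟩ :=
      exists_zsmul_add_zsmul_of_minimal hzM hwM hzw hnorm hmin (r := r) hv
    exact ⟨a, b, by rw [hab]⟩

/-- By Lagrange's identity the determinant is `±|z|²`; the sign `ε` is the orientation, and `|w - ε
i z|²` expands to 0. -/
theorem eq_quarter_turn_of_orthogonal {z w : GaussianInt}
    (hnorm : z.re ^ 2 + z.im ^ 2 = w.re ^ 2 + w.im ^ 2) (hc : z.re * w.re + z.im * w.im = 0) :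
    ∃ ε : ℤ, ε * ε = 1 ∧ w.re = -(ε * z.im) ∧ w.im = ε * z.re ∧
      z.re * w.im - z.im * w.re = ε * (z.re ^ 2 + z.im ^ 2) := by
  have key : ∀ ε : ℤ, ε * ε = 1 → z.re * w.im - z.im * w.re = ε * (z.re ^ 2 + z.im ^ 2) →
      w.re = -(ε * z.im) ∧ w.im = ε * z.re := by
    intro ε hε h
    have h0 : (w.re + ε * z.im) ^ 2 + (w.im - ε * z.re) ^ 2 = 0 := by
      linear_combination -hnorm - 2 * ε * h - (z.re ^ 2 + z.im ^ 2) * hε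
    have h1 : w.re + ε * z.im = 0 := by nlinarith [sq_nonneg (w.im - ε * z.re)]
    have h2 : w.im - ε * z.re = 0 := by nlinarith [sq_nonneg (w.re + ε * z.im)]
    exact ⟨by linarith, by linarith⟩
  have hsq : (z.re * w.im - z.im * w.re) ^ 2 = (z.re ^ 2 + z.im ^ 2) ^ 2 := by
    linear_combination -(z.re ^ 2 + z.im ^ 2) * hnorm - (z.re * w.re + z.im * w.im) * hc
  rcases sq_eq_sq_iff_eq_or_eq_neg.1 hsq with h | h
  · exact ⟨1, rfl, (key 1 rfl (by rw [h, one_mul])).1, (key 1 rfl (by rw [h, one_mul])).2,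
      by rw [h, one_mul]⟩
  · exact ⟨-1, rfl, (key (-1) rfl (by rw [h, neg_one_mul])).1,
      (key (-1) rfl (by rw [h, neg_one_mul])).2, by rw [h, neg_one_mul]⟩

/-- Since `w = ε i z` with `ε = ±1`, the integer combinations of `z` and `w` are exactly the
Gaussian multiples of `z`. -/
theorem comesFromIdeal_span_singleton {L : Submodule ℤ (EuclideanSpace ℝ (Fin 2))}
    {z w : GaussianInt} (hz : gaussianToPlane z ∈ L) (hw : gaussianToPlane w ∈ L)
    (hgen : ∀ v ∈ L, ∃ a b : ℤ, v = gaussianToPlane (a • z + b • w))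
    {ε : ℤ} (hε : ε * ε = 1) (hre : w.re = -(ε * z.im)) (him : w.im = ε * z.re) :
    ComesFromIdeal L (Ideal.span {z}) := by
  ext v
  simp only [Set.mem_image, SetLike.mem_coe, Ideal.mem_span_singleton']
  constructor
  · rintro ⟨_, ⟨r, rfl⟩, rfl⟩
    have : r * z = r.re • z + (ε * r.im) • w := by
      ext
      · simp [hre]
        linear_combination -(r.im * z.im) * hε
      · simp [him]
        linear_combination -r.im * z.re * hε
    rw [this, gaussianToPlane_add, gaussianToPlane_zsmul, gaussianToPlane_zsmul]
    exact L.add_mem (L.smul_mem _ hz) (L.smul_mem _ hw)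
  · intro hv
    obtain ⟨a, b, rfl⟩ := hgen v hv
    refine ⟨_, ⟨⟨a, ε * b⟩, ?_⟩, rfl⟩
    ext
    · simp [hre]
      ring
    · simp [him]
      ring

theorem mainTheorem9 (u : ℕ) (huD : (u : ℝ) ∈ wrDetSet)
    (hu : (∃ p k : ℕ, p.Prime ∧ 1 ≤ k ∧ (u = p ^ k ∨ u = 2 * p ^ k)) ∨
      (∃ p₁ p₂ : ℕ, p₁.Prime ∧ Odd p₁ ∧ p₂.Prime ∧ Odd p₂ ∧
        √3 * (p₁ : ℝ) < (p₂ : ℝ) ∧ u = p₁ * p₂))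
    (L : Submodule ℤ (EuclideanSpace ℝ (Fin 2))) (hL : L ∈ WR (intLattice 2))
    (hdet : ZLattice.covolume L = (u : ℝ)) :
    (∃ I : Ideal GaussianInt, gaussianIdealNorm I = u ∧ ComesFromIdeal L I) ∧
      HasOrthogonalBasis L := by
  obtain ⟨z, w, hz, hw, hzw, hnorm, hc, hgen⟩ := exists_minimal_generators hL
  obtain ⟨b, hb0, hb1⟩ := exists_basis_gaussianToPlane hz hw hzw hgen
  have : DiscreteTopology L := discreteTopology_of_le_intLattice hL.1
  have : IsZLattice ℝ L := ⟨hL.2.1⟩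
  have hdetu : (z.re * w.im - z.im * w.re).natAbs = u := by
    rw [covolume_eq_abs_det b, hb0, hb1] at hdet
    simp only [gaussianToPlane, PiLp.toLp_apply, Matrix.cons_val_zero, Matrix.cons_val_one]
      at hdet
    have h : |z.re * w.im - z.im * w.re| = (u : ℤ) := by exact_mod_cast hdet
    rwa [Int.abs_eq_natAbs, Nat.cast_inj] at h
  have hc0 := dot_eq_zero_of_special hu hdetu hzw hnorm hc
  obtain ⟨ε, hε, hre, him, hD⟩ := eq_quarter_turn_of_orthogonal hnorm hc0
  refine ⟨⟨Ideal.span {z}, ?_, comesFromIdeal_span_singleton hz hw hgen hε hre him⟩, b, ?_⟩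
  · have h1 : ε.natAbs = 1 := Int.isUnit_iff_natAbs_eq.1 (IsUnit.of_mul_eq_one _ hε)
    rw [gaussianIdealNorm_span_singleton, ← hdetu, hD, Int.natAbs_mul, h1, one_mul]
  · rw [hb0, hb1, inner_gaussianToPlane, hc0, Int.cast_zero]
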